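/- Let $Z$ be a metric space, let $N\ge 1$, let $I^N=[0,1]^N\subset\mathbb{R}^N$, and let $\widehat X=(X,h)$ be a generalized $N$-dimensional rectangle of $Z$, that is, $X\subseteq Z$ and $h:I^N\to X$ is a homeomorphism of $I^N$ onto $X$. For $i\in\{1,\dots,N\}$ put $$X_i^{\ell}:=h(\{x\in I^N: x_i=0\}),\qquad X_i^{r}:=h(\{x\in I^N: x_i=1\}).$$ A set $\mathcal S\subseteq X$ is said to cut the arcs between $A$ and $B$ in $X$ (where $A,B\subseteq X$) if every continuous path $\gamma:[0,1]\to X$ whose range meets both $A$ and $B$ has a range that meets $\mathcal S$. Let $k\in\{1,\dots,N\}$ be fixed. Assume that for each $j\in\{1,\dots,N\}$ with $j\neq k$ there is a compact set $\mathcal S_j\subseteq X$ which cuts the arcs between $X_j^{\ell}$ and $X_j^{r}$ in $X$. Then $\bigcap_{j\ne k}\mathcal S_j\neq\emptyset$, and there exists a compact connected set $\mathcal C\subseteq\bigcap_{j\neq k}\mathcal S_j$ such that $$\mathcal C\cap X_k^{\ell}\neq\emptyset,\qquad \mathcal C\cap X_k^{r}\neq\emptyset.$$ (For $N=1$ the empty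 intersection is understood to be $X$.) -/

import Mathlib

/-- The unit cube `[0,1]^N` in `ℝ^N`. -/
def unitCube (N : ℕ) : Set (Fin N → ℝ) := {x | ∀ i, x i ∈ Set.Icc (0 : ℝ) 1}

/-- A generalized `N`-dimensional rectangle of a metric space `Z`: a subset `X` of `Z` together
with a homeomorphism `h` of the unit cube `[0,1]^N` onto `X`. -/
structure GeneralizedRectangle (N : ℕ) (Z : Type*) [MetricSpace Z] where
  X : Set Z
  h : unitCube N ≃ₜ X

/-- The left `i`-face `h([x_i = 0])`, as a subset of the ambient space. -/
def GeneralizedRectangle.leftFace {N : ℕ} {Z : Type*} [MetricSpace Z]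
    (R : GeneralizedRectangle N Z) (i : Fin N) : Set Z :=
  (fun x : unitCube N => (R.h x : Z)) '' {x | (x : Fin N → ℝ) i = 0}

/-- The right `i`-face `h([x_i = 1])`, as a subset of the ambient space. -/
def GeneralizedRectangle.rightFace {N : ℕ} {Z : Type*} [MetricSpace Z]
    (R : GeneralizedRectangle N Z) (i : Fin N) : Set Z :=
  (fun x : unitCube N => (R.h x : Z)) '' {x | (x : Fin N → ℝ) i = 1}

/-- `C` cuts the arcs between `A` and `B` in `X`: every path `γ : [0,1] → X` whose range meets
both `A` and `B` has a range that meets `C`. -/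
def CutsArcsIn {Z : Type*} [MetricSpace Z] (X A B C : Set Z) : Prop :=
  ∀ γ : C(unitInterval, Z), Set.range γ ⊆ X →
    (Set.range γ ∩ A).Nonempty → (Set.range γ ∩ B).Nonempty → (Set.range γ ∩ C).Nonempty

/-!
Transported to the cube, the theorem is deduced from the Poincaré–Miranda theorem
(`exists_forall_eq_zero_of_faces`). Each cut set `S j` contains the zero set of a continuous
function that is `≤ 0` on the left and `≥ 0` on the right `j`-face: the distance to `S j`, signed
according to whether a point can be reached from the left face without crossing `S j`
(`exists_continuous_zeroSet_subset`). If no component of `K = ⋂ j ≠ k, S j` met both `k`-faces, then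
`K` would split into two disjoint compact parts, one missing the right and one missing the left
`k`-face (`exists_isClopen_of_forall_connectedComponent`). A Urysohn function separating
these parts and these faces, shifted by `1 / 2`, would be a `k`-th function without zeros on `K`,
whereas the Poincaré–Miranda theorem gives a common zero of all `N` functions.

The Poincaré–Miranda theorem follows by compactness from a combinatorial statement on a grid: if
`0`-cochains `c a` mod 2 are `0` on the left and `1` on the right `a`-faces, then some unit cube has
both labels of every `c a` (`exists_cube_forall_exists_eq`). Indeed, the cup product of the
coboundaries `δ(c a)` vanishes on every cube on which some `c a` is constant, while its sum over all
unit cubes is `1`: as it is the coboundary of the product with `c a` in place of the first factor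
`δ(c a)`, a discrete Stokes formula reduces the sum to the right `a`-face, and induction on the
number of factors applies (`sum_cupDiff_eq_one`).
-/

/-! ### Cubical cochains mod 2 -/

/-- The coboundary, mod 2, of a cubical cochain on the grid `ℕ^ι`. A cochain `β` is evaluated on
the unit cube with lower corner `x` and edge directions `S` as `β S x`. -/
def cubeCoboundary {ι : Type*} [DecidableEq ι] (β : Finset ι → (ι → ℕ) → ZMod 2)
    (S : Finset ι) (x : ι → ℕ) : ZMod 2 :=
  ∑ a ∈ S, (β (S.erase a) (x + Pi.single a 1) + β (S.erase a) x)

/-- The cup product `δc₁ ∪ ⋯ ∪ δcₙ` of the coboundaries of a list of `0`-cochains. Evaluated on a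
cube of dimension `n`, it is the sum over the monotone edge paths `x = v₀, …, vₙ` through the cube
of the products of the increments `c_i (v_i) - c_i (v_{i-1})`. The empty product is taken to be `1`
on cubes of every dimension; only cubes of dimension `n` matter. -/
def cupDiff {ι : Type*} [DecidableEq ι] :
    List ((ι → ℕ) → ZMod 2) → Finset ι → (ι → ℕ) → ZMod 2
  | [], _, _ => 1
  | c :: cs, S, x =>
    ∑ a ∈ S, (c (x + Pi.single a 1) + c x) * cupDiff cs (S.erase a) (x + Pi.single a 1)

section Cochains

variable {ι : Type*} [DecidableEq ι]

theorem cubeCoboundary_cubeCoboundary (β : Finset ι → (ι → ℕ) → ZMod 2) :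
    cubeCoboundary (cubeCoboundary β) = 0 := by
  ext S x
  simp only [cubeCoboundary, ← Finset.sum_add_distrib, Pi.zero_apply]
  rw [Finset.sum_sigma']
  refine Finset.sum_involution (fun p _ => ⟨p.2, p.1⟩) ?_ ?_ ?_ ?_
  · rintro ⟨a, b⟩ _
    simp only [Finset.erase_right_comm (a := b) (b := a),
      add_right_comm x (Pi.single b 1) (Pi.single a 1)]
    rw [← CharTwo.add_self_eq_zero (β ((S.erase a).erase b) (x + Pi.single a 1 + Pi.single b 1) +
      β ((S.erase a).erase b) (x + Pi.single a 1) + (β ((S.erase a).erase b) (x + Pi.single b 1) +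
      β ((S.erase a).erase b) x))]
    ring
  · rintro ⟨a, b⟩ h _ he
    simp only [Finset.mem_sigma, Finset.mem_erase] at h
    simp only [Sigma.mk.injEq, heq_eq_eq] at he
    exact h.2.1 he.1
  · rintro ⟨a, b⟩ h
    simp only [Finset.mem_sigma, Finset.mem_erase] at h ⊢
    exact ⟨h.2.2, h.2.1.symm, h.1⟩
  · rintro ⟨a, b⟩ _
    rfl

/-- The Leibniz rule for the cup product of a `0`-cochain with a cochain. -/
theorem cubeCoboundary_mul (c : (ι → ℕ) → ZMod 2) (β : Finset ι → (ι → ℕ) → ZMod 2)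
    (S : Finset ι) (x : ι → ℕ) :
    cubeCoboundary (fun S x => c x * β S x) S x =
      ∑ a ∈ S, (c (x + Pi.single a 1) + c x) * β (S.erase a) (x + Pi.single a 1) +
        c x * cubeCoboundary β S x := by
  simp only [cubeCoboundary, Finset.mul_sum, ← Finset.sum_add_distrib]
  refine Finset.sum_congr rfl fun a _ => ?_
  linear_combination -CharTwo.add_self_eq_zero (c x * β (S.erase a) (x + Pi.single a 1))

/-- A product of coboundaries is closed, and it is the coboundary of the product in which the first
factor `δc` is replaced by `c`. -/
theorem cubeCoboundary_cupDiff (cs : List ((ι → ℕ) → ZMod 2)) :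
    cubeCoboundary (cupDiff cs) = 0 ∧ ∀ c, cupDiff (c :: cs) =
      cubeCoboundary (fun S x => c x * cupDiff cs S x) := by
  have key : ∀ cs : List ((ι → ℕ) → ZMod 2), cubeCoboundary (cupDiff cs) = 0 →
      ∀ c, cupDiff (c :: cs) = cubeCoboundary (fun S x => c x * cupDiff cs S x) := by
    intro cs h c
    ext S x
    rw [cubeCoboundary_mul, h]
    simp [cupDiff]
  have closed : cubeCoboundary (cupDiff cs) = 0 := by
    induction cs with
    | nil =>
      ext S x
      exact Finset.sum_eq_zero fun a _ => CharTwo.add_self_eq_zero 1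
    | cons c cs ih => rw [key cs ih, cubeCoboundary_cubeCoboundary]
  exact ⟨closed, key cs closed⟩

/-- The product vanishes on a cube on whose vertices one of the `0`-cochains is constant. -/
theorem cupDiff_eq_zero_of_const {c : (ι → ℕ) → ZMod 2} {r : ZMod 2} :
    ∀ {cs : List ((ι → ℕ) → ZMod 2)} {S : Finset ι} {x : ι → ℕ}, c ∈ cs →
    (∀ y, (∀ b, x b ≤ y b ∧ y b ≤ x b + 1) → (∀ b ∉ S, y b = x b) → c y = r) →
    cupDiff cs S x = 0
  | d :: cs, S, x, hc, h => by
    refine Finset.sum_eq_zero fun a ha => ?_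
    rcases List.mem_cons.1 hc with rfl | hc
    · rw [h x (by simp) (by simp), h (x + Pi.single a 1), CharTwo.add_self_eq_zero, zero_mul]
      · intro b
        by_cases hb : b = a
        · subst hb; simp
        · simp [hb]
      · intro b hb
        have : b ≠ a := fun e => hb (e ▸ ha)
        simp [this]
    · rw [cupDiff_eq_zero_of_const hc, mul_zero]
      intro y hy hyS
      have hya := hyS a (by simp)
      refine h y (fun b => ?_) fun b hb => ?_
      · by_cases hba : b = a
        · subst hba; simp [hya]
        · simpa [hba] using hy b
      · have hba : b ≠ a := fun e => hb (e ▸ ha)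
        simpa [hba] using hyS b (by simp [hb])

end Cochains

/-! ### Discrete Stokes formula and the grid lemma -/

/-- The lower corners of the unit cubes, with edge directions `S`, that subdivide the face of
`[0, m]^ι` on which the coordinates outside `S` equal `m`. -/
def gridFace {ι : Type*} [DecidableEq ι] [Fintype ι] (m : ℕ) (S : Finset ι) : Finset (ι → ℕ) :=
  Fintype.piFinset fun a => if a ∈ S then Finset.range m else {m}

section Stokes

variable {ι : Type*} [DecidableEq ι] [Fintype ι]

theorem mem_gridFace {m : ℕ} {S : Finset ι} {x : ι → ℕ} :
    x ∈ gridFace m S ↔ ∀ a, (a ∈ S → x a < m) ∧ (a ∉ S → x a = m) := by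
  simp only [gridFace, Fintype.mem_piFinset]
  refine forall_congr' fun a => ?_
  by_cases h : a ∈ S <;> simp [h]

/-- Summation over a grid face along the lines of direction `a`. -/
theorem sum_gridFace_eq_sum_erase {m : ℕ} {S : Finset ι} {a : ι} (ha : a ∈ S)
    (F : (ι → ℕ) → ZMod 2) :
    ∑ x ∈ gridFace m S, F x =
      ∑ y ∈ gridFace m (S.erase a), ∑ t ∈ Finset.range m, F (Function.update y a t) := by
  rw [← Finset.sum_product']
  refine Finset.sum_bij' (fun x _ => (Function.update x a m, x a))
    (fun p _ => Function.update p.1 a p.2) ?_ ?_ ?_ ?_ ?_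
  · intro x hx
    rw [mem_gridFace] at hx
    rw [Finset.mem_product, mem_gridFace, Finset.mem_range]
    refine ⟨fun b => ?_, (hx a).1 ha⟩
    by_cases hb : b = a
    · subst hb; simp
    · simpa [hb] using hx b
  · rintro ⟨y, t⟩ hp
    rw [Finset.mem_product, mem_gridFace, Finset.mem_range] at hp
    rw [mem_gridFace]
    intro b
    by_cases hb : b = a
    · subst hb; simpa [ha] using hp.2
    · simpa [hb] using hp.1 b
  · intro x _; simp
  · rintro ⟨y, t⟩ hp
    rw [Finset.mem_product, mem_gridFace] at hp
    have := (hp.1 a).2 (by simp)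
    refine Prod.ext (funext fun b => ?_) (by simp)
    by_cases hb : b = a
    · subst hb; simpa using this.symm
    · simp [hb]
  · intro x _; simp

/-- Mod 2, the sum of the increments in direction `a` telescopes to the two `a`-faces. -/
theorem sum_gridFace_add_single {m : ℕ} {S : Finset ι} {a : ι} (ha : a ∈ S)
    (F : (ι → ℕ) → ZMod 2) :
    ∑ x ∈ gridFace m S, (F (x + Pi.single a 1) + F x) =
      ∑ y ∈ gridFace m (S.erase a), (F y + F (Function.update y a 0)) := by
  rw [sum_gridFace_eq_sum_erase ha]
  refine Finset.sum_congr rfl fun y hy => ?_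
  have hya : y a = m := (mem_gridFace.1 hy a).2 (by simp)
  have hs : ∀ t, Function.update y a t + Pi.single a 1 = Function.update y a (t + 1) := by
    intro t
    ext b
    by_cases hb : b = a
    · subst hb; simp
    · simp [hb]
  have := Finset.sum_range_sub (fun t => F (Function.update y a t)) m
  simp only [CharTwo.sub_eq_add] at this
  simp only [hs, this]
  rw [← hya, Function.update_eq_self]

/-- By Stokes, the sum of `δc_a ∪ β` over a grid face equals that of `c_a ∪ β` over its boundary.
Here only the face on which the `a`-th coordinate is `m` contributes: `c_a` vanishes on the opposite
one, and on each remaining pair of faces some factor of `β` does. -/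
theorem sum_cupDiff_eq_one {m : ℕ} (c : ι → (ι → ℕ) → ZMod 2)
    (h0 : ∀ a x, x a = 0 → c a x = 0) (h1 : ∀ a x, x a = m → c a x = 1) :
    ∀ l : List ι, l.Nodup → ∑ x ∈ gridFace m l.toFinset, cupDiff (l.map c) l.toFinset x = 1
  | [], _ => by
    have : gridFace m (∅ : Finset ι) = {fun _ => m} := by
      ext x; simp [mem_gridFace, funext_iff]
    simp [this, cupDiff]
  | a :: l, hl => by
    obtain ⟨hal, hl'⟩ := List.nodup_cons.1 hl
    rw [← sum_cupDiff_eq_one c h0 h1 l hl', List.map_cons, (cubeCoboundary_cupDiff _).2]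
    simp only [cubeCoboundary]
    rw [Finset.sum_comm]
    have her : (a :: l).toFinset.erase a = l.toFinset := by
      ext b; simp only [List.toFinset_cons, Finset.mem_erase, Finset.mem_insert,
        List.mem_toFinset]; grind
    rw [Finset.sum_eq_single_of_mem a (by simp)]
    · rw [sum_gridFace_add_single (by simp)
        (fun x => c a x * cupDiff (l.map c) ((a :: l).toFinset.erase a) x), her]
      refine Finset.sum_congr rfl fun y hy => ?_
      have hya : y a = m := (mem_gridFace.1 hy a).2 (by simpa using hal)
      rw [h1 a y hya, h0 a _ (by simp)]
      ring
    · intro b hb hba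
      rw [sum_gridFace_add_single hb
        (fun x => c a x * cupDiff (l.map c) ((a :: l).toFinset.erase b) x)]
      have hbl : c b ∈ l.map c := by
        refine List.mem_map_of_mem ?_
        simpa [hba] using hb
      refine Finset.sum_eq_zero fun y hy => ?_
      have hyb : y b = m := (mem_gridFace.1 hy b).2 (by simp)
      rw [cupDiff_eq_zero_of_const (r := 1) hbl, cupDiff_eq_zero_of_const (r := 0) hbl]
      · simp
      · intro z _ hz
        exact h0 b z (by simpa using hz b (by simp))
      · intro z _ hz
        exact h1 b z (by rw [hz b (by simp), hyb])

/-- If each labelling `c a` is `0` on the left and `1` on the right `a`-face of the grid, some unit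
cube has vertices of both labels for every `a`. -/
theorem exists_cube_forall_exists_eq {m : ℕ} (c : ι → (ι → ℕ) → ZMod 2)
    (h0 : ∀ a x, x a = 0 → c a x = 0) (h1 : ∀ a x, x a = m → c a x = 1) :
    ∃ x : ι → ℕ, ∀ a, ∀ r : ZMod 2,
      ∃ y, (∀ b, x b ≤ y b ∧ y b ≤ x b + 1) ∧ c a y = r := by
  have hsum := sum_cupDiff_eq_one c h0 h1 _ (Finset.nodup_toList Finset.univ)
  rw [Finset.toList_toFinset] at hsum
  obtain ⟨x, -, hne⟩ := Finset.exists_ne_zero_of_sum_ne_zero (hsum.trans_ne one_ne_zero)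
  refine ⟨x, fun a r => ?_⟩
  by_contra! hcon
  refine hne (cupDiff_eq_zero_of_const (c := c a) (r := r + 1)
    (List.mem_map_of_mem (by simp)) fun y hy _ => ?_)
  have := hcon y hy
  generalize c a y = s at this
  clear hcon
  revert r s
  decide

end Stokes

open Filter Topology

/-! ### The unit cube and its grid points -/

/-- The grid point `x / m`, its coordinates being truncated at `1`. -/
noncomputable def gridPoint {N : ℕ} (m : ℕ) (x : Fin N → ℕ) : unitCube N :=
  ⟨fun a => (min (x a) m : ℕ) / (m : ℝ), fun a => ⟨by positivity,
    div_le_one_of_le₀ (by exact_mod_cast min_le_right _ _) (by positivity)⟩⟩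

theorem dist_gridPoint_le {N m : ℕ} {x y : Fin N → ℕ} (h : ∀ b, x b ≤ y b ∧ y b ≤ x b + 1) :
    dist (gridPoint m x) (gridPoint m y) ≤ 1 / (m : ℝ) := by
  rw [Subtype.dist_eq, dist_pi_le_iff (by positivity)]
  intro b
  simp only [gridPoint]
  rw [Real.dist_eq, ← sub_div, abs_div, Nat.abs_cast]
  gcongr
  have h1 : ((min (x b) m : ℕ) : ℝ) ≤ (min (y b) m : ℕ) := by
    exact_mod_cast min_le_min_right m (h b).1
  have h2 : ((min (y b) m : ℕ) : ℝ) ≤ (min (x b) m : ℕ) + 1 := by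
    have := (h b).2
    exact_mod_cast (by omega : min (y b) m ≤ min (x b) m + 1)
  rw [abs_le]
  constructor <;> linarith

theorem unitCube_eq_pi (N : ℕ) : unitCube N = Set.univ.pi fun _ => Set.Icc (0 : ℝ) 1 := by
  ext x
  simp only [unitCube, Set.mem_ofPred_eq, Set.mem_univ_pi]

theorem isCompact_unitCube (N : ℕ) : IsCompact (unitCube N) := by
  rw [unitCube_eq_pi]
  exact isCompact_univ_pi fun _ => isCompact_Icc

instance {N : ℕ} : CompactSpace (unitCube N) :=
  isCompact_iff_compactSpace.1 (isCompact_unitCube N)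

theorem convex_unitCube (N : ℕ) : Convex ℝ (unitCube N) := by
  rw [unitCube_eq_pi]
  exact convex_pi fun _ _ => convex_Icc 0 1

/-! ### The Poincaré–Miranda theorem -/

/-- The **Poincaré–Miranda theorem**: continuous functions `f a` on the cube with `f a ≤ 0` on the
left `a`-face and `f a ≥ 0` on the right `a`-face have a common zero. -/
theorem exists_forall_eq_zero_of_faces {N : ℕ} (f : Fin N → unitCube N → ℝ)
    (hf : ∀ a, Continuous (f a))
    (h0 : ∀ a (x : unitCube N), (x : Fin N → ℝ) a = 0 → f a x ≤ 0)
    (h1 : ∀ a (x : unitCube N), (x : Fin N → ℝ) a = 1 → 0 ≤ f a x) :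
    ∃ x, ∀ a, f a x = 0 := by
  classical
  -- On the grid of mesh `1 / (n + 1)`, label a vertex by the sign of `f a`, imposing the labels
  -- `0` and `1` on the two `a`-faces, where `f a` may vanish.
  have step : ∀ n : ℕ, ∃ x : unitCube N, ∀ a, ∃ y z : unitCube N,
      dist x y ≤ 1 / ((n : ℝ) + 1) ∧ dist x z ≤ 1 / ((n : ℝ) + 1) ∧ f a y ≤ 0 ∧ 0 ≤ f a z := by
    intro n
    obtain ⟨x, hx⟩ := exists_cube_forall_exists_eq (ι := Fin N) (m := n + 1)
      (fun a x => if x a = n + 1 ∨ (x a ≠ 0 ∧ 0 < f a (gridPoint (n + 1) x)) then 1 else 0)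
      (fun a x h => if_neg (by simp [h])) (fun a x h => if_pos (Or.inl h))
    refine ⟨gridPoint (n + 1) x, fun a => ?_⟩
    obtain ⟨y, hy, hy0⟩ := hx a 0
    obtain ⟨z, hz, hz1⟩ := hx a 1
    refine ⟨gridPoint (n + 1) y, gridPoint (n + 1) z, ?_, ?_, ?_, ?_⟩
    · exact_mod_cast dist_gridPoint_le hy
    · exact_mod_cast dist_gridPoint_le hz
    · have : ¬ (y a = n + 1 ∨ (y a ≠ 0 ∧ 0 < f a (gridPoint (n + 1) y))) := by
        intro h
        simp only [if_pos h] at hy0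
        exact one_ne_zero hy0
      push Not at this
      by_cases hya : y a = 0
      · exact h0 a _ (by simp only [gridPoint, hya, Nat.zero_min, Nat.cast_zero, zero_div])
      · exact this.2 hya
    · have : z a = n + 1 ∨ (z a ≠ 0 ∧ 0 < f a (gridPoint (n + 1) z)) := by
        by_contra h
        simp only [if_neg h] at hz1
        exact zero_ne_one hz1
      rcases this with h | h
      · refine h1 a _ ?_
        simp only [gridPoint, h, min_self]
        exact div_self (by positivity)
      · exact h.2.le
  choose x hx using step
  choose y z hy hz hfy hfz using hx
  obtain ⟨p, -, φ, hφ, hp⟩ := isCompact_univ.tendsto_subseq fun n => Set.mem_univ (x n)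
  have hlim : Tendsto (fun n : ℕ => 1 / ((φ n : ℝ) + 1)) atTop (𝓝 0) :=
    tendsto_one_div_add_atTop_nhds_zero_nat.comp hφ.tendsto_atTop
  have lim : ∀ u : ℕ → unitCube N, (∀ n, dist (x n) (u n) ≤ 1 / ((n : ℝ) + 1)) →
      Tendsto (fun n => u (φ n)) atTop (𝓝 p) := fun u hu =>
    (tendsto_iff_of_dist (squeeze_zero (fun _ => dist_nonneg) (fun n => hu (φ n)) hlim)).1 hp
  refine ⟨p, fun a => le_antisymm ?_ ?_⟩
  · exact le_of_tendsto' (((hf a).tendsto p).comp (lim (fun n => y n a) fun n => hy n a))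
      fun n => hfy (φ n) a
  · exact ge_of_tendsto' (((hf a).tendsto p).comp (lim (fun n => z n a) fun n => hz n a))
      fun n => hfz (φ n) a

/-! ### Functions attached to cut sets and to separations -/

/-- In a compact Hausdorff space, two closed sets that no component meets both of are separated by
a clopen set: the space of components is compact, Hausdorff and totally disconnected. -/
theorem exists_isClopen_of_forall_connectedComponent {K : Type*} [TopologicalSpace K]
    [CompactSpace K] [T2Space K] {A B : Set K} (hA : IsClosed A) (hB : IsClosed B)
    (h : ∀ x ∈ A, Disjoint (connectedComponent x) B) :
    ∃ U : Set K, IsClopen U ∧ A ⊆ U ∧ Disjoint U B := by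
  have hq := ConnectedComponents.continuous_coe (α := K)
  obtain ⟨V, hV, hAV, hVB⟩ := exists_clopen_of_closed_subset_open
    (hA.isCompact.image hq).isClosed (hB.isCompact.image hq).isClosed.isOpen_compl (by
      rintro _ ⟨a, ha, rfl⟩ ⟨b, hb, hba⟩
      exact Set.disjoint_left.1 (h a ha) (ConnectedComponents.coe_eq_coe'.1 hba) hb)
  refine ⟨_, hV.preimage hq, Set.image_subset_iff.1 hAV, Set.disjoint_left.2 fun b hb hbB => ?_⟩
  exact hVB hb ⟨b, hbB, rfl⟩

theorem joinedIn_of_ball {N : ℕ} {T : Set (unitCube N)} {p u w : unitCube N} {ε : ℝ}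
    (hε : Metric.ball p ε ⊆ Tᶜ) (hu : u ∈ Metric.ball p ε) (hw : w ∈ Metric.ball p ε) :
    JoinedIn Tᶜ u w := by
  have hconv : Convex ℝ (unitCube N ∩ Metric.ball (p : Fin N → ℝ) ε) :=
    (convex_unitCube N).inter (convex_ball _ _)
  have hpc := hconv.isPathConnected ⟨u, u.2, hu⟩
  obtain ⟨γ, hγ⟩ := hpc.joinedIn u ⟨u.2, hu⟩ w ⟨w.2, hw⟩
  exact ⟨⟨⟨fun t => ⟨γ t, (hγ t).1⟩, by fun_prop⟩, by simp, by simp⟩, fun t => hε (hγ t).2⟩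

/-- A closed set that cuts the paths between the two `j`-faces contains the zero set of a
continuous function with the signs required by the Poincaré–Miranda theorem, namely the distance
to the set, taken negative on the part of the complement reachable from the left face. -/
theorem exists_continuous_zeroSet_subset {N : ℕ} {j : Fin N} {T : Set (unitCube N)}
    (hT : IsClosed T)
    (hcut : ∀ x y : unitCube N, (x : Fin N → ℝ) j = 0 → (y : Fin N → ℝ) j = 1 →
      ¬ JoinedIn Tᶜ x y) :
    ∃ f : unitCube N → ℝ, Continuous f ∧
      (∀ x : unitCube N, (x : Fin N → ℝ) j = 0 → f x ≤ 0) ∧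
      (∀ x : unitCube N, (x : Fin N → ℝ) j = 1 → 0 ≤ f x) ∧ ∀ x, f x = 0 → x ∈ T := by
  classical
  let o : unitCube N := ⟨0, fun _ => by simp⟩
  let e : unitCube N := ⟨1, fun _ => by simp⟩
  -- For empty `T`, `infDist` would be the junk value `0`.
  have hne : T.Nonempty := by
    rw [Set.nonempty_iff_ne_empty]
    rintro rfl
    refine hcut o e rfl rfl (joinedIn_of_ball (p := o) (ε := dist e o + 1) (by simp) ?_ ?_)
    · exact Metric.mem_ball_self (by positivity)
    · simp
  set U : Set (unitCube N) := {x | ∃ y : unitCube N, (y : Fin N → ℝ) j = 0 ∧ JoinedIn Tᶜ y x}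
    with hU
  refine ⟨fun x => if x ∈ U then -Metric.infDist x T else Metric.infDist x T, ?_, ?_, ?_, ?_⟩
  · refine Continuous.if (fun p hp => ?_) (Metric.continuous_infDist_pt T).neg
      (Metric.continuous_infDist_pt T)
    -- A ball missing `T` lies entirely inside or entirely outside `U`.
    suffices p ∈ T by simp [Metric.infDist_zero_of_mem this]
    by_contra hpT
    obtain ⟨ε, hε, hball⟩ := Metric.isOpen_iff.1 hT.isOpen_compl p hpT
    rw [frontier_eq_closure_inter_closure] at hp
    obtain ⟨u, hu, y, hy, hyu⟩ := mem_closure_iff.1 hp.1 _ Metric.isOpen_ball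
      (Metric.mem_ball_self hε)
    obtain ⟨w, hw, hwU⟩ := mem_closure_iff.1 hp.2 _ Metric.isOpen_ball (Metric.mem_ball_self hε)
    exact hwU ⟨y, hy, hyu.trans (joinedIn_of_ball hball hu hw)⟩
  · intro x hx
    by_cases hxT : x ∈ T
    · simp [Metric.infDist_zero_of_mem hxT]
    · have : x ∈ U := ⟨x, hx, JoinedIn.refl hxT⟩
      simp [this, Metric.infDist_nonneg]
  · intro x hx
    have : x ∉ U := fun ⟨y, hy, hyx⟩ => hcut y x hy hx hyx
    simp [this, Metric.infDist_nonneg]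
  · intro x hx
    rw [hT.mem_iff_infDist_zero hne]
    by_cases h : x ∈ U <;> simpa [h] using hx

/-! ### The connected set joining the two faces -/

/-- The theorem for the cube itself, with cutting expressed by `JoinedIn`. -/
theorem exists_connected_subset_iInter {N : ℕ} (k : Fin N) (T : Fin N → Set (unitCube N))
    (hT : ∀ j, j ≠ k → IsClosed (T j))
    (hcut : ∀ j, j ≠ k → ∀ x y : unitCube N, (x : Fin N → ℝ) j = 0 → (y : Fin N → ℝ) j = 1 →
      ¬ JoinedIn (T j)ᶜ x y) :
    ∃ C : Set (unitCube N), (∀ j, j ≠ k → C ⊆ T j) ∧ IsCompact C ∧ IsConnected C ∧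
      (∃ x ∈ C, (x : Fin N → ℝ) k = 0) ∧ ∃ x ∈ C, (x : Fin N → ℝ) k = 1 := by
  classical
  set K : Set (unitCube N) := ⋂ j, ⋂ (_ : j ≠ k), T j with hK
  have hKc : IsClosed K := isClosed_iInter fun j => isClosed_iInter (hT j)
  have hcoord : Continuous fun x : unitCube N => (x : Fin N → ℝ) k :=
    (continuous_apply k).comp continuous_subtype_val
  have hF0 : IsClosed {x : unitCube N | (x : Fin N → ℝ) k = 0} := isClosed_eq hcoord (by fun_prop)
  have hF1 : IsClosed {x : unitCube N | (x : Fin N → ℝ) k = 1} := isClosed_eq hcoord (by fun_prop)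
  have : CompactSpace K := isCompact_iff_compactSpace.1 hKc.isCompact
  by_contra hno
  -- If no component of `K` meets both faces, `K` splits into two parts, and a Urysohn function of
  -- the parts provides the missing `k`-th function, which takes only the values `0`, `1` on `K`.
  obtain ⟨V, hV, h0V, hV1⟩ := exists_isClopen_of_forall_connectedComponent
    (hF0.preimage (continuous_subtype_val (p := (· ∈ K))))
    (hF1.preimage (continuous_subtype_val (p := (· ∈ K)))) (by
      intro x hx
      rw [Set.disjoint_left]
      intro y hy hy1
      refine hno ⟨(↑) '' connectedComponent x, ?_, ?_, ?_, ⟨x, ⟨x, mem_connectedComponent, rfl⟩, hx⟩,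
        ⟨y, ⟨y, hy, rfl⟩, hy1⟩⟩
      · rintro j hj _ ⟨z, -, rfl⟩
        have := z.2
        simp only [hK, Set.mem_iInter] at this
        exact this j hj
      · exact isClosed_connectedComponent.isCompact.image continuous_subtype_val
      · exact isConnected_connectedComponent.image _ continuous_subtype_val.continuousOn)
  have hcl : ∀ W : Set K, IsClosed W → IsClosed (((↑) : K → unitCube N) '' W) := fun W hW =>
    (hW.isCompact.image continuous_subtype_val).isClosed
  obtain ⟨g, hg0, hg1, -⟩ := exists_continuous_zero_one_of_isClosed
    ((hcl V hV.1).union hF0) ((hcl Vᶜ hV.compl.1).union hF1) (by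
      rw [Set.disjoint_left]
      rintro x (⟨v, hv, rfl⟩ | hx0) (⟨w, hw, hwx⟩ | hx1)
      · exact hw (Subtype.ext hwx ▸ hv)
      · exact Set.disjoint_left.1 hV1 hv hx1
      · subst hwx; exact hw (h0V hx0)
      · exact zero_ne_one (hx0.symm.trans hx1))
  have hfun : ∀ j, ∃ f : unitCube N → ℝ, Continuous f ∧
      (∀ x : unitCube N, (x : Fin N → ℝ) j = 0 → f x ≤ 0) ∧
      (∀ x : unitCube N, (x : Fin N → ℝ) j = 1 → 0 ≤ f x) ∧
      (∀ x, f x = 0 → if j = k then g x = 1 / 2 else x ∈ T j) := by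
    intro j
    by_cases hj : j = k
    · subst hj
      refine ⟨fun x => g x - 1 / 2, by fun_prop, fun x hx => ?_, fun x hx => ?_, fun x hx => ?_⟩
      · norm_num [hg0 (Or.inr hx)]
      · norm_num [hg1 (Or.inr hx)]
      · rw [if_pos rfl]; linarith
    · simpa only [if_neg hj] using exists_continuous_zeroSet_subset (hT j hj) (hcut j hj)
  choose f hfc hf0 hf1 hfz using hfun
  obtain ⟨x, hx⟩ := exists_forall_eq_zero_of_faces f hfc hf0 hf1
  have hgx : g x = 1 / 2 := by simpa using hfz k x (hx k)
  have hxK : x ∈ K := by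
    simp only [hK, Set.mem_iInter]
    intro j hj
    simpa [hj] using hfz j x (hx j)
  by_cases hxV : (⟨x, hxK⟩ : K) ∈ V
  · have := hg0 (Or.inl ⟨_, hxV, rfl⟩)
    norm_num [hgx] at this
  · have := hg1 (Or.inl ⟨_, hxV, rfl⟩)
    norm_num [hgx] at this

theorem mainTheorem5 {Z : Type*} [MetricSpace Z] {N : ℕ} (R : GeneralizedRectangle N Z)
    (k : Fin N) (S : Fin N → Set Z)
    (hS : ∀ j, j ≠ k → IsCompact (S j) ∧ S j ⊆ R.X ∧
      CutsArcsIn R.X (R.leftFace j) (R.rightFace j) (S j)) :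
    (R.X ∩ ⋂ j, ⋂ (_ : j ≠ k), S j).Nonempty ∧
    ∃ C : Set Z, C ⊆ R.X ∩ (⋂ j, ⋂ (_ : j ≠ k), S j) ∧ IsCompact C ∧ IsConnected C ∧
      (C ∩ R.leftFace k).Nonempty ∧ (C ∩ R.rightFace k).Nonempty := by
  have hh : Continuous fun x : unitCube N => (R.h x : Z) := by fun_prop
  obtain ⟨C, hCT, hCc, hCconn, ⟨x, hxC, hx⟩, ⟨y, hyC, hy⟩⟩ :=
    exists_connected_subset_iInter k (fun j => (fun x : unitCube N => (R.h x : Z)) ⁻¹' S j)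
      (fun j hj => (hS j hj).1.isClosed.preimage hh) (by
        rintro j hj x y hx hy ⟨γ, hγ⟩
        obtain ⟨_, ⟨t, rfl⟩, ht⟩ := (hS j hj).2.2
          ⟨fun t => (R.h (γ t) : Z), hh.comp γ.continuous⟩
          (by rintro _ ⟨t, rfl⟩; exact (R.h (γ t)).2)
          ⟨_, ⟨0, rfl⟩, x, hx, by simp⟩ ⟨_, ⟨1, rfl⟩, y, hy, by simp⟩
        exact hγ t ht)
  have hsub : (fun x : unitCube N => (R.h x : Z)) '' C ⊆ R.X ∩ ⋂ j, ⋂ (_ : j ≠ k), S j := by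
    rintro _ ⟨z, hz, rfl⟩
    exact ⟨(R.h z).2, Set.mem_iInter₂.2 fun j hj => hCT j hj hz⟩
  exact ⟨⟨_, hsub ⟨x, hxC, rfl⟩⟩, _, hsub, hCc.image hh, hCconn.image _ hh.continuousOn,
    ⟨_, ⟨x, hxC, rfl⟩, x, hx, rfl⟩, ⟨_, ⟨y, hyC, rfl⟩, y, hy, rfl⟩⟩
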